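/- Let $\nu$ be a nonatomic, $\sigma$-finite measure on $[0,1]$ with $\nu([0,1])=\infty$ and $\int_0^1 w\,\nu(dw)<\infty$. Let $(w_i)_{i\in\mathbb N}$ be a random sequence in $[0,1]$ distributed as a Poisson point process with rate measure $\nu$, that is, $\#\{i: w_i\in A\}\sim\mathrm{Poisson}(\nu(A))$ for every measurable $A\subseteq[0,1]$ with $\nu(A)<\infty$, and the counts $\#\{i:w_i\in A_j\}$ are independent for every finite collection of disjoint measurable sets $A_j$. Put $w_{\{i,j\}}=w_iw_j$ if $i\ne j$ and $w_{\{i,i\}}=0$. Let $n\ge 0$ be an integer and suppose that, conditionally on $(w_i)_i$, the edge multiplicities $M_{\{i,j\}}$ are independent with $M_{\{i,j\}}\sim\mathrm{Binom}(n,w_{\{i,j\}})$. Let $E_n$ be the multiset that contains each edge $\{i,j\}$ with multiplicity $M_{\{i,j\}}$, let $V_n=\{i:\sum_j M_{\{i,j\}}>0\}$ be the set of active vertices, let $\bar E_n$ be the set of edges of multiplicity at least $1$ in $E_n$, and let $\bar V_n=V_n$ be the set of active vertices of the resulting binary graph. Then the following expectations are finite and \[ \mathbb E|\bar V_n|=\mathbb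 E|V_n|=\int\Bigl[1-\exp\Bigl(-\int\bigl(1-(1-wv)^n\bigr)\,\nu(dv)\Bigr)\Bigr]\nu(dw), \] \[ \mathbb E|E_n|=\frac n2\iint wv\,\nu(dw)\,\nu(dv),\qquad \mathbb E|\bar E_n|=\frac12\iint\bigl(1-(1-wv)^n\bigr)\,\nu(dw)\,\nu(dv), \] where all the integrals on the right-hand sides converge. -/

import Mathlib

open MeasureTheory ProbabilityTheory
open scoped ENNReal unitInterval

noncomputable section

/-- The number `#{i : wᵢ ∈ A}` of points of the sequence `w` in the set `A`. -/
def pointCount {Ω : Type*} (w : ℕ → Ω → I) (A : Set I) (ω : Ω) : ℕ∞ :=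
  {i : ℕ | w i ω ∈ A}.encard

/-- `(wᵢ) ∼ PPP(ν)` on `[0,1]`: counts in sets of finite `ν`-measure are Poisson, and counts in
finitely many disjoint sets are independent. -/
structure IsPoissonPointProcess {Ω : Type*} [MeasurableSpace Ω] (P : Measure Ω)
    (w : ℕ → Ω → I) (ν : Measure I) : Prop where
  measurable : ∀ i, Measurable (w i)
  poisson : ∀ A : Set I, MeasurableSet A → ν A ≠ ∞ →
    HasLaw (pointCount w A) ((poissonMeasure (ν A).toNNReal).map (fun k : ℕ => (k : ℕ∞))) P
  indep : ∀ (J : ℕ) (A : Fin J → Set I), (∀ j, MeasurableSet (A j)) →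
    Pairwise (fun j k => Disjoint (A j) (A k)) →
    iIndepFun (fun j => pointCount w (A j)) P

/-- The edge rates: `w_{i,j} = wᵢ wⱼ` if `i ≠ j`, and `w_{i,i} = 0`. -/
def edgeRate (w : ℕ → I) : Sym2 ℕ → I :=
  Sym2.lift ⟨fun i j => if i = j then 0 else w i * w j, fun i j => by
    simp only [eq_comm (a := i) (b := j), mul_comm (w i) (w j)]⟩

/-- Conditionally on the weights `w`, the multiplicities `M e` are independent, and `M e` is
binomial with parameters `n` and the rate of `e`: every finite family of them has the
corresponding conditional joint probability mass function given `σ(w₀, w₁, …)`. -/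
structure IsEdgeMultiplicity {Ω : Type*} [MeasurableSpace Ω] (P : Measure Ω)
    (w : ℕ → Ω → I) (n : ℕ) (M : Sym2 ℕ → Ω → ℕ) : Prop where
  measurable : ∀ e, Measurable (M e)
  condLaw : ∀ (S : Finset (Sym2 ℕ)) (k : Sym2 ℕ → ℕ),
    P⟦{ω | ∀ e ∈ S, M e ω = k e} |
        MeasurableSpace.comap (fun ω (i : ℕ) => w i ω) MeasurableSpace.pi⟧
      =ᵐ[P] fun ω => ∏ e ∈ S, (binomial n (edgeRate (fun i => w i ω) e)).real {k e}

/-- The active vertices of a multigraph given by its edge multiplicities. -/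
def activeVertices (G : Sym2 ℕ → ℕ) : Set ℕ := {i | ∃ j, 0 < G s(i, j)}

/-- The number of active vertices, possibly `∞`. -/
def vertexCount (G : Sym2 ℕ → ℕ) : ℝ≥0∞ := ((activeVertices G).encard : ℝ≥0∞)

/-- The number of edges counted with multiplicity, possibly `∞`. -/
def edgeCount (G : Sym2 ℕ → ℕ) : ℝ≥0∞ := ∑' e, (G e : ℝ≥0∞)

/-- The binary graph of a multigraph: the same edges, each with multiplicity one. -/
def binaryGraph (G : Sym2 ℕ → ℕ) : Sym2 ℕ → ℕ := fun e => if 0 < G e then 1 else 0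

/-- The `[0,∞]`-valued random variable `X` is measurable with finite expectation `a`. -/
def HasExpectation {Ω : Type*} [MeasurableSpace Ω] (P : Measure Ω)
    (X : Ω → ℝ≥0∞) (a : ℝ) : Prop :=
  AEMeasurable X P ∧ 0 ≤ a ∧ ∫⁻ ω, X ω ∂P = ENNReal.ofReal a

end

/-!
Everything rests on Mecke's equation `E ∑ᵢ F(wᵢ, ∑_{j ≠ i} δ_{wⱼ}) = ∫ E F(x, ∑ⱼ δ_{wⱼ}) ν(dx)`.
If `F` only sees finitely many labels of the points, it is the Stein–Chen identity
`E[N G(N - 1)] = r E[G(N)]` of a Poisson variable `N` of mean `r`, applied to the independent counts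
of the labels; such `F` determine the measures on both sides.

Given the weights, the vertex `i` is isolated with probability `∏_{j ≠ i} (1 - wᵢ wⱼ)ⁿ`, a function
of `wᵢ` and of the other points. By Mecke's equation the expected number of active vertices is the
`ν(dx)`-integral of one minus the expectation of `∏ⱼ (1 - x wⱼ)ⁿ`, and the latter is the Laplace
functional of the point process at `y ↦ -n log (1 - x y)`. For the edges, two applications of
Mecke's equation show that the pairs of distinct points have intensity `ν ⊗ ν`, and each edge comes
from two such pairs.
-/

open Filter Topology

/-- The exponential `e⁻ᵗ` of an extended nonnegative number `t`, with `e^{-∞} = 0`. Laplace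
functionals of point processes with infinitely many points are stated with it. -/
noncomputable def expNeg (t : ℝ≥0∞) : ℝ≥0∞ := EReal.exp (-(t : EReal))

namespace expNeg

@[simp] theorem apply_zero : expNeg 0 = 1 := by simp [expNeg]

theorem apply_add (s t : ℝ≥0∞) : expNeg (s + t) = expNeg s * expNeg t := by
  rw [expNeg, EReal.coe_ennreal_add, EReal.neg_add (by simp) (by simp), sub_eq_add_neg,
    EReal.exp_add]
  rfl

theorem apply_ofReal {x : ℝ} (hx : 0 ≤ x) :
    expNeg (ENNReal.ofReal x) = ENNReal.ofReal (Real.exp (-x)) := by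
  rw [expNeg, EReal.coe_ennreal_ofReal, max_eq_left hx, ← EReal.coe_neg, EReal.exp_coe]

theorem continuous : Continuous expNeg :=
  ENNReal.continuous_exp.comp (continuous_neg.comp continuous_coe_ennreal_ereal)

theorem antitone : Antitone expNeg := fun s t h => by
  simpa [expNeg] using h

theorem apply_le_one (t : ℝ≥0∞) : expNeg t ≤ 1 := apply_zero ▸ antitone zero_le

theorem apply_lt_one {t : ℝ≥0∞} (ht : t ≠ 0) : expNeg t < 1 := by
  simpa [expNeg, pos_iff_ne_zero] using ht

@[simp] theorem eq_zero_iff {t : ℝ≥0∞} : expNeg t = 0 ↔ t = ∞ := by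
  simp [expNeg, EReal.neg_eq_bot_iff]

theorem apply_natCast_mul (k : ℕ) (t : ℝ≥0∞) : expNeg (k * t) = expNeg t ^ k := by
  induction k with
  | zero => simp
  | succ k ih => rw [Nat.cast_succ, add_mul, one_mul, apply_add, ih, pow_succ]

theorem apply_sum {ι : Type*} (s : Finset ι) (f : ι → ℝ≥0∞) :
    expNeg (∑ i ∈ s, f i) = ∏ i ∈ s, expNeg (f i) := by
  classical
  induction s using Finset.induction_on with
  | empty => simp
  | insert i s hi ih => rw [Finset.sum_insert hi, Finset.prod_insert hi, apply_add, ih]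

end expNeg

theorem natCast_succ_mul_poissonMeasure_singleton (r : NNReal) (k : ℕ) :
    ((k + 1 : ℕ) : ℝ≥0∞) * poissonMeasure r {k + 1} = r * poissonMeasure r {k} := by
  rw [poissonMeasure_singleton, poissonMeasure_singleton, ← ENNReal.ofReal_natCast,
    ← ENNReal.ofReal_coe_nnreal, ← ENNReal.ofReal_mul (by positivity),
    ← ENNReal.ofReal_mul (by positivity), Nat.factorial_succ]
  congr 1
  push_cast
  field_simp
  ring

theorem lintegral_pow_poissonMeasure (r : NNReal) {q : NNReal} (hq : q ≤ 1) :
    ∫⁻ k : ℕ, (q : ℝ≥0∞) ^ k ∂poissonMeasure r = expNeg (r * (1 - q)) := by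
  have hsum : HasSum (fun k : ℕ => Real.exp (-r) * r ^ k / k.factorial * (q : ℝ) ^ k)
      (Real.exp (-(r * (1 - q)))) := by
    have h := (NormedSpace.expSeries_div_hasSum_exp ((r : ℝ) * q)).mul_left (Real.exp (-r))
    rw [← Real.exp_eq_exp_ℝ, ← Real.exp_add] at h
    have hterm (k : ℕ) : Real.exp (-r) * r ^ k / k.factorial * (q : ℝ) ^ k =
        Real.exp (-r) * ((r * q) ^ k / k.factorial) := by ring
    simp_rw [hterm, show -(r * (1 - q) : ℝ) = -r + r * q by ring]
    exact h
  rw [lintegral_countable', ← ENNReal.coe_one, ← ENNReal.coe_sub, ← ENNReal.coe_mul,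
    ← ENNReal.ofReal_coe_nnreal (p := r * (1 - q)), expNeg.apply_ofReal (by positivity),
    NNReal.coe_mul, NNReal.coe_sub hq, NNReal.coe_one, ← hsum.tsum_eq,
    ENNReal.ofReal_tsum_of_nonneg (fun k => by positivity) hsum.summable]
  refine tsum_congr fun k => ?_
  rw [poissonMeasure_singleton, ENNReal.ofReal_mul (by positivity),
    ENNReal.ofReal_pow (by positivity), ENNReal.ofReal_coe_nnreal, mul_comm]

/-- The Poisson law with parameter `r ∈ [0,∞]`, a measure on `ℕ∞`; for `r = ∞` it is the unit mass
at `∞`. It is the law of the number of points in a set of arbitrary measure. -/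
noncomputable def poissonENat (r : ℝ≥0∞) : Measure ℕ∞ :=
  if r = ∞ then .dirac ⊤ else (poissonMeasure r.toNNReal).map fun k : ℕ => (k : ℕ∞)

namespace poissonENat

@[simp] theorem apply_top : poissonENat ∞ = .dirac ⊤ := if_pos rfl

theorem apply_coe (r : NNReal) :
    poissonENat r = (poissonMeasure r).map fun k : ℕ => (k : ℕ∞) := by
  simp [poissonENat]

instance (r : ℝ≥0∞) : IsProbabilityMeasure (poissonENat r) := by
  induction r with
  | top => rw [apply_top]; infer_instance
  | coe r => rw [apply_coe]; exact Measure.isProbabilityMeasure_map (by fun_prop)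

theorem lintegral_coe (r : NNReal) (F : ℕ∞ → ℝ≥0∞) :
    ∫⁻ k, F k ∂poissonENat r = ∫⁻ k : ℕ, F k ∂poissonMeasure r := by
  rw [apply_coe, lintegral_map .of_discrete .of_discrete]

theorem lintegral_mul_sub_one (r : ℝ≥0∞) (F : ℕ∞ → ℝ≥0∞) :
    ∫⁻ k, (k : ℝ≥0∞) * F (k - 1) ∂poissonENat r = r * ∫⁻ k, F k ∂poissonENat r := by
  induction r with
  | top => simp
  | coe r =>
    rw [lintegral_coe, lintegral_coe, lintegral_countable', lintegral_countable',
      tsum_eq_zero_add' ENNReal.summable, ← ENNReal.tsum_mul_left]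
    simp only [Nat.cast_zero, ENat.toENNReal_zero, zero_mul, zero_add]
    refine tsum_congr fun j => ?_
    rw [ENat.toENNReal_coe, mul_right_comm, natCast_succ_mul_poissonMeasure_singleton,
      Nat.cast_succ, ENat.addLECancellable_of_ne_top ENat.one_ne_top |>.add_tsub_cancel_right]
    ring

theorem lintegral_expNeg_mul (r s : ℝ≥0∞) :
    ∫⁻ k, expNeg (s * k) ∂poissonENat r = expNeg (r * (1 - expNeg s)) := by
  simp_rw [mul_comm s]
  induction r with
  | top =>
    rcases eq_or_ne s 0 with rfl | hs
    · simp
    · have h : expNeg s < 1 := expNeg.apply_lt_one hs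
      simp [ENNReal.top_mul, hs, (tsub_pos_of_lt h).ne']
  | coe r =>
    obtain ⟨q, hq⟩ : ∃ q : NNReal, expNeg s = q :=
      ⟨_, (ENNReal.coe_toNNReal ((expNeg.apply_le_one s).trans_lt ENNReal.one_lt_top).ne).symm⟩
    have hq1 : q ≤ 1 := by exact_mod_cast hq ▸ expNeg.apply_le_one s
    simp_rw [lintegral_coe, ENat.toENNReal_coe, expNeg.apply_natCast_mul, hq,
      lintegral_pow_poissonMeasure r hq1]

theorem lintegral_pi_mul_sub_single {α : Type*} [Fintype α] [DecidableEq α] (r : α → ℝ≥0∞)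
    (F : (α → ℕ∞) → ℝ≥0∞) (l : α) :
    ∫⁻ k, (k l : ℝ≥0∞) * F (k - Pi.single l 1) ∂(Measure.pi fun m => poissonENat (r m)) =
      r l * ∫⁻ k, F k ∂(Measure.pi fun m => poissonENat (r m)) := by
  have hupdate (k : α → ℕ∞) (j : ℕ∞) :
      Function.update k l j - Pi.single l 1 = Function.update k l (j - 1) := by
    ext m
    rcases eq_or_ne m l with rfl | hm <;> simp [*]
  have hl := Finset.mem_univ l
  rw [lintegral_eq_lmarginal_univ 0, lintegral_eq_lmarginal_univ 0,
    lmarginal_erase' _ .of_discrete hl, lmarginal_erase' _ .of_discrete hl]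
  simp only [Function.update_self, hupdate]
  simp_rw [fun k => lintegral_mul_sub_one (r l) fun j => F (Function.update k l j)]
  rw [lmarginal, lmarginal, lintegral_const_mul _ .of_discrete]

end poissonENat

/-- The point measure `∑ᵢ δ_{xᵢ}` of a family of points, counted with repetitions. -/
noncomputable def pointMeasure {ι X : Type*} [MeasurableSpace X] (x : ι → X) : Measure X :=
  Measure.sum fun i => Measure.dirac (x i)

/-- The point measure `∑_{j ≠ i} δ_{xⱼ}` of the remaining points, which is how the `i`-th point
sees the other ones. -/
noncomputable def reducedPointMeasure {ι X : Type*} [MeasurableSpace X] (x : ι → X) (i : ι) :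
    Measure X :=
  pointMeasure fun j : {j // j ≠ i} => x j

section PointMeasure

variable {ι X Y Ω : Type*} [MeasurableSpace X] [MeasurableSpace Y] [MeasurableSpace Ω]

theorem pointMeasure_apply (x : ι → X) {A : Set X} (hA : MeasurableSet A) :
    pointMeasure x A = ((x ⁻¹' A).encard : ℝ≥0∞) := by
  rw [pointMeasure, Measure.sum_apply _ hA, ← ENNReal.tsum_set_one,
    tsum_subtype _ fun _ => (1 : ℝ≥0∞)]
  exact tsum_congr fun i => Measure.dirac_apply' _ hA

theorem map_pointMeasure (x : ι → X) {f : X → Y} (hf : Measurable f) :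
    (pointMeasure x).map f = pointMeasure fun i => f (x i) := by
  simp_rw [pointMeasure, Measure.map_sum hf.aemeasurable, Measure.map_dirac' hf]

theorem lintegral_pointMeasure (x : ι → X) {f : X → ℝ≥0∞} (hf : Measurable f) :
    ∫⁻ y, f y ∂pointMeasure x = ∑' i, f (x i) := by
  simp_rw [pointMeasure, lintegral_sum_measure, lintegral_dirac' _ hf]

theorem measurable_pointMeasure [Countable ι] {x : ι → Ω → X} (hx : ∀ i, Measurable (x i)) :
    Measurable fun ω => pointMeasure fun i => x i ω := by
  refine Measure.measurable_of_measurable_coe _ fun A hA => ?_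
  simp_rw [pointMeasure, Measure.sum_apply _ hA, Measure.dirac_apply' _ hA]
  exact Measurable.tsum fun i => (measurable_one.indicator hA).comp (hx i)

theorem measurable_reducedPointMeasure [Countable ι] {x : ι → Ω → X} (hx : ∀ i, Measurable (x i))
    (i : ι) : Measurable fun ω => reducedPointMeasure (fun j => x j ω) i :=
  measurable_pointMeasure fun j => hx j

theorem measurableSet_forall_apply_mem {t : Finset (Set X)} (ht : ∀ s ∈ t, MeasurableSet s)
    {U : Set X → Set ℝ≥0∞} (hU : ∀ s ∈ t, MeasurableSet (U s)) :
    MeasurableSet {μ : Measure X | ∀ s ∈ t, μ s ∈ U s} := by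
  simp_rw [Set.ofPred_forall]
  exact t.measurableSet_biInter fun s hs => Measure.measurable_coe (ht s hs) (hU s hs)

/-- The number of members of the family `v` that are equal to `l`. The fiber counts of the labels
of a Poisson process are independent Poisson variables. -/
noncomputable def fiberCount {ι α : Type*} (v : ι → α) (l : α) : ℕ∞ :=
  (v ⁻¹' {l}).encard

/-- The measure on `α` with mass `k l` at each `l`, through which the point measure of a family of
labels is a function of its fiber counts. -/
noncomputable def countMeasure {α : Type*} [MeasurableSpace α] (k : α → ℕ∞) : Measure α :=
  Measure.sum fun l => (k l : ℝ≥0∞) • Measure.dirac l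

variable {α : Type*} [MeasurableSpace α] [MeasurableSingletonClass α]

theorem measurable_fiberCount [Countable ι] {v : ι → Ω → α} (hv : ∀ i, Measurable (v i)) :
    Measurable fun ω => fiberCount fun i => v i ω :=
  measurable_pi_lambda _ fun l => measurable_encard.comp <|
    measurable_set_iff.2 fun i => measurable_mem.2 (hv i (measurableSet_singleton l))

variable [Countable α]

theorem pointMeasure_eq_countMeasure (v : ι → α) :
    pointMeasure v = countMeasure (fiberCount v) := by
  rw [countMeasure, ← Measure.sum_smul_dirac (pointMeasure v)]
  simp_rw [pointMeasure_apply v (measurableSet_singleton _), fiberCount]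

theorem reducedPointMeasure_eq_countMeasure [DecidableEq α] (v : ι → α) (i : ι) :
    reducedPointMeasure v i =
      countMeasure (fiberCount v - Pi.single (v i) 1) := by
  rw [reducedPointMeasure, pointMeasure_eq_countMeasure]
  congr 1 with l
  have himage : Subtype.val '' ((fun j : {j // j ≠ i} => v j) ⁻¹' {l}) = v ⁻¹' {l} \ {i} := by
    ext j
    simp [and_comm]
  rw [fiberCount, ← Subtype.val_injective.encard_image, himage, Pi.sub_apply, fiberCount]
  by_cases hl : i ∈ v ⁻¹' {l}
  · rw [Set.encard_sdiff_singleton_of_mem hl]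
    obtain rfl : v i = l := hl
    rw [Pi.single_eq_same]
  · rw [Set.sdiff_singleton_eq_self hl, Pi.single_eq_of_ne' (M := fun _ => ℕ∞) hl, tsub_zero]

theorem tsum_reducedPointMeasure [DecidableEq α] (v : ι → α) (F : α → Measure α → ℝ≥0∞) :
    ∑' i, F (v i) (reducedPointMeasure v i) = ∑' l, (fiberCount v l : ℝ≥0∞) *
      F l (countMeasure (fiberCount v - Pi.single l 1)) := by
  rw [← ENNReal.tsum_fiberwise _ v]
  refine tsum_congr fun l => ?_
  rw [fiberCount, ← ENNReal.tsum_set_const]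
  refine tsum_congr fun ⟨i, hi⟩ => ?_
  obtain rfl : v i = l := hi
  rw [reducedPointMeasure_eq_countMeasure]

end PointMeasure

section PoissonPointProcess

variable {Ω : Type*} [MeasurableSpace Ω] {P : Measure Ω} {ν : Measure I} {w : ℕ → Ω → I}

theorem measurable_pointCount (hw : ∀ i, Measurable (w i)) {A : Set I} (hA : MeasurableSet A) :
    Measurable (pointCount w A) :=
  measurable_encard.comp (measurable_set_iff.2 fun i => measurable_mem.2 (hw i hA))

namespace IsPoissonPointProcess

theorem lintegral_expNeg_pointCount (hw : IsPoissonPointProcess P w ν) {A : Set I}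
    (hA : MeasurableSet A) (hνA : ν A ≠ ∞) :
    ∫⁻ ω, expNeg (pointCount w A ω) ∂P = expNeg (ν A * (1 - expNeg 1)) := by
  have hlaw := hw.poisson A hA hνA
  rw [← poissonENat.apply_coe, ENNReal.coe_toNNReal hνA] at hlaw
  rw [← poissonENat.lintegral_expNeg_mul, ← hlaw.lintegral_comp Measurable.of_discrete.aemeasurable]
  simp

theorem ae_pointCount_eq_top [SigmaFinite ν] (hw : IsPoissonPointProcess P w ν) {A : Set I}
    (hA : MeasurableSet A) (hνA : ν A = ∞) : ∀ᵐ ω ∂P, pointCount w A ω = ⊤ := by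
  have hS (m : ℕ) := hA.inter (measurableSet_spanningSets ν m)
  have hfin (m : ℕ) : ν (A ∩ spanningSets ν m) ≠ ∞ :=
    measure_inter_ne_top_of_right_ne_top (measure_spanningSets_lt_top ν m).ne
  have hle (m : ℕ) : ∫⁻ ω, expNeg (pointCount w A ω) ∂P ≤
      expNeg (ν (A ∩ spanningSets ν m) * (1 - expNeg 1)) := by
    rw [← hw.lintegral_expNeg_pointCount (hS m) (hfin m)]
    exact lintegral_mono fun ω => expNeg.antitone <|
      ENat.toENNReal_mono <| Set.encard_le_encard fun _ hi => Set.inter_subset_left hi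
  have htend : Tendsto (fun m => ν (A ∩ spanningSets ν m)) atTop (𝓝 ∞) := by
    have h := tendsto_measure_iUnion_atTop (μ := ν) (s := fun m => A ∩ spanningSets ν m)
      fun m m' h => Set.inter_subset_inter_right A (monotone_spanningSets ν h)
    rwa [← Set.inter_iUnion, iUnion_spanningSets, Set.inter_univ, hνA] at h
  have hpos : 1 - expNeg 1 ≠ 0 := (tsub_pos_of_lt (expNeg.apply_lt_one one_ne_zero)).ne'
  have hlim := (expNeg.continuous.tendsto _).comp
    (ENNReal.Tendsto.mul_const htend (.inr (by simp)) : Tendsto _ _ (𝓝 (∞ * (1 - expNeg 1))))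
  have hzero : ∫⁻ ω, expNeg (pointCount w A ω) ∂P = 0 := by
    rw [ENNReal.top_mul hpos, expNeg.eq_zero_iff.2 rfl] at hlim
    exact le_zero_iff.1 (ge_of_tendsto' hlim hle)
  have hm : Measurable fun ω => expNeg (pointCount w A ω) :=
    (Measurable.of_discrete (f := fun k : ℕ∞ => expNeg k)).comp
      (measurable_pointCount hw.measurable hA)
  filter_upwards [(lintegral_eq_zero_iff hm).1 hzero] with ω hω
  simpa using hω

theorem hasLaw_pointCount [SigmaFinite ν] [IsProbabilityMeasure P]
    (hw : IsPoissonPointProcess P w ν) {A : Set I} (hA : MeasurableSet A) :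
    HasLaw (pointCount w A) (poissonENat (ν A)) P := by
  by_cases hνA : ν A = ∞
  · refine ⟨(measurable_pointCount hw.measurable hA).aemeasurable, ?_⟩
    rw [Measure.map_congr (hw.ae_pointCount_eq_top hA hνA), hνA, poissonENat.apply_top,
      Measure.map_const, measure_univ, one_smul]
  · simpa [poissonENat, hνA] using hw.poisson A hA hνA

variable {α : Type*} [MeasurableSpace α] [MeasurableSingletonClass α]

theorem iIndepFun_pointCount_fiber [Finite α] (hw : IsPoissonPointProcess P w ν) {a : I → α}
    (ha : Measurable a) : iIndepFun (fun l => pointCount w (a ⁻¹' {l})) P := by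
  let e := Finite.equivFin α
  have h := hw.indep (Nat.card α) (fun j => a ⁻¹' {e.symm j})
    (fun j => ha (measurableSet_singleton _)) fun j k hjk =>
      Disjoint.preimage a (Set.disjoint_singleton.2 (e.symm.injective.ne hjk))
  simpa using h.precomp e.injective

theorem hasLaw_fiberCount [Fintype α] [SigmaFinite ν] [IsProbabilityMeasure P]
    (hw : IsPoissonPointProcess P w ν) {a : I → α} (ha : Measurable a) :
    HasLaw (fun ω => fiberCount fun i => a (w i ω))
      (Measure.pi fun l => poissonENat (ν (a ⁻¹' {l}))) P := by
  have hm (l : α) := measurable_pointCount hw.measurable (ha (measurableSet_singleton l))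
  refine ⟨(measurable_pi_lambda _ hm).aemeasurable, ?_⟩
  simp_rw [← fun l => (hw.hasLaw_pointCount (ha (measurableSet_singleton l))).map_eq]
  exact (iIndepFun_iff_map_fun_eq_pi_map fun l => (hm l).aemeasurable).1
    (hw.iIndepFun_pointCount_fiber ha)

end IsPoissonPointProcess

end PoissonPointProcess

section Mecke

variable {Ω : Type*} [MeasurableSpace Ω] {P : Measure Ω} {ν : Measure I} {w : ℕ → Ω → I}

namespace IsPoissonPointProcess

section Fiber

variable {α : Type*} [Finite α] [MeasurableSpace α] [MeasurableSingletonClass α]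

theorem lintegral_fiberCount_mul [DecidableEq α] [SigmaFinite ν] [IsProbabilityMeasure P]
    (hw : IsPoissonPointProcess P w ν) {a : I → α} (ha : Measurable a)
    (G : (α → ℕ∞) → ℝ≥0∞) (l : α) :
    ∫⁻ ω, (fiberCount (fun i => a (w i ω)) l : ℝ≥0∞) *
        G (fiberCount (fun i => a (w i ω)) - Pi.single l 1) ∂P =
      ν (a ⁻¹' {l}) * ∫⁻ ω, G (fiberCount fun i => a (w i ω)) ∂P := by
  have := Fintype.ofFinite α
  have hlaw := hw.hasLaw_fiberCount ha
  have h := poissonENat.lintegral_pi_mul_sub_single (fun l => ν (a ⁻¹' {l})) G l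
  rwa [← hlaw.lintegral_comp Measurable.of_discrete.aemeasurable,
    ← hlaw.lintegral_comp Measurable.of_discrete.aemeasurable] at h

theorem tsum_lintegral_fiber [SigmaFinite ν] [IsProbabilityMeasure P]
    (hw : IsPoissonPointProcess P w ν) {a : I → α} (ha : Measurable a)
    (F : α → Measure α → ℝ≥0∞) :
    ∑' i, ∫⁻ ω, F (a (w i ω)) (reducedPointMeasure (fun j => a (w j ω)) i) ∂P =
      ∫⁻ x, ∫⁻ ω, F (a x) (pointMeasure fun j => a (w j ω)) ∂P ∂ν := by
  classical
  have := Fintype.ofFinite α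
  have haw (i : ℕ) : Measurable fun ω => a (w i ω) := ha.comp (hw.measurable i)
  have hK := measurable_fiberCount haw
  have hm (i : ℕ) : Measurable fun ω =>
      F (a (w i ω)) (reducedPointMeasure (fun j => a (w j ω)) i) := by
    simp_rw [reducedPointMeasure_eq_countMeasure]
    have hF : Measurable fun p : α × (α → ℕ∞) => F p.1 (countMeasure (p.2 - Pi.single p.1 1)) :=
      .of_discrete
    exact hF.comp ((haw i).prodMk hK)
  have hm' (l : α) : Measurable fun ω => (fiberCount (fun i => a (w i ω)) l : ℝ≥0∞) *
      F l (countMeasure (fiberCount (fun i => a (w i ω)) - Pi.single l 1)) := by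
    have hF : Measurable fun k : α → ℕ∞ => (k l : ℝ≥0∞) * F l (countMeasure (k - Pi.single l 1)) :=
      .of_discrete
    exact hF.comp hK
  calc _ = ∫⁻ ω, ∑ l, (fiberCount (fun i => a (w i ω)) l : ℝ≥0∞) *
        F l (countMeasure (fiberCount (fun i => a (w i ω)) - Pi.single l 1)) ∂P := by
        rw [← lintegral_tsum fun i => (hm i).aemeasurable]
        exact lintegral_congr fun ω => (tsum_reducedPointMeasure _ F).trans (tsum_fintype _)
    _ = ∑ l, ν (a ⁻¹' {l}) * ∫⁻ ω, F l (pointMeasure fun i => a (w i ω)) ∂P := by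
        simp_rw [lintegral_finsetSum _ fun l _ => hm' l, pointMeasure_eq_countMeasure]
        exact Finset.sum_congr rfl fun l _ =>
          hw.lintegral_fiberCount_mul ha (fun k => F l (countMeasure k)) l
    _ = _ := by
        rw [← lintegral_map (f := fun l => ∫⁻ ω, F l (pointMeasure fun i => a (w i ω)) ∂P)
          .of_discrete ha, lintegral_fintype]
        simp_rw [Measure.map_apply ha (measurableSet_singleton _), mul_comm]

end Fiber

theorem tsum_measure_cylinder [SigmaFinite ν] [IsProbabilityMeasure P]
    (hw : IsPoissonPointProcess P w ν) {A : Set I} (hA : MeasurableSet A) {t : Finset (Set I)}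
    (ht : ∀ s ∈ t, MeasurableSet s) {U : Set I → Set ℝ≥0∞} (hU : ∀ s ∈ t, MeasurableSet (U s)) :
    ∑' i, P {ω | w i ω ∈ A ∧ ∀ s ∈ t, reducedPointMeasure (fun j => w j ω) i s ∈ U s} =
      ν A * P {ω | ∀ s ∈ t, pointMeasure (fun j => w j ω) s ∈ U s} := by
  classical
  -- The event only depends on the labels that record membership in `A` and in the members of `t`.
  let a (x : I) : Prop × (t → Prop) := (x ∈ A, fun s => x ∈ s.1)
  have ha : Measurable a := (measurable_mem.2 hA).prodMk
    (measurable_pi_lambda _ fun s => measurable_mem.2 (ht s s.2))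
  have hlabel {ι : Type} (x : ι → I) (s : t) :
      pointMeasure (fun i => a (x i)) {m | m.2 s} = pointMeasure x s := by
    rw [← map_pointMeasure x ha, Measure.map_apply ha .of_discrete]
    rfl
  have hcyl := measurableSet_forall_apply_mem ht hU
  have hred (i : ℕ) : MeasurableSet
      {ω | w i ω ∈ A ∧ ∀ s ∈ t, reducedPointMeasure (fun j => w j ω) i s ∈ U s} :=
    (hw.measurable i hA).inter (measurable_reducedPointMeasure hw.measurable i hcyl)
  have hpt : MeasurableSet {ω | ∀ s ∈ t, pointMeasure (fun j => w j ω) s ∈ U s} :=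
    measurable_pointMeasure hw.measurable hcyl
  calc _ = ∑' i, ∫⁻ ω, (if (a (w i ω)).1 then
        {μ | ∀ s : t, μ {m | m.2 s} ∈ U s}.indicator 1
          (reducedPointMeasure (fun j => a (w j ω)) i) else 0) ∂P := by
        refine tsum_congr fun i => ?_
        rw [← lintegral_indicator_one (hred i)]
        refine lintegral_congr fun ω => ?_
        simp [Set.indicator_apply, reducedPointMeasure, hlabel, a, ite_and]
    _ = _ := hw.tsum_lintegral_fiber ha fun l μ =>
        if l.1 then {μ | ∀ s : t, μ {m | m.2 s} ∈ U s}.indicator 1 μ else 0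
    _ = ∫⁻ x, A.indicator (fun _ =>
        P {ω | ∀ s ∈ t, pointMeasure (fun j => w j ω) s ∈ U s}) x ∂ν := by
        refine lintegral_congr fun x => ?_
        rw [← lintegral_indicator_one hpt]
        by_cases hx : x ∈ A <;> simp [Set.indicator_apply, hlabel, a, hx]
    _ = _ := by rw [lintegral_indicator_const hA, mul_comm]

theorem mecke_equation [SigmaFinite ν] [IsProbabilityMeasure P]
    (hw : IsPoissonPointProcess P w ν) :
    Measure.sum (fun i => P.map fun ω => (w i ω, reducedPointMeasure (fun j => w j ω) i)) =
      ν.prod (P.map fun ω => pointMeasure fun j => w j ω) := by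
  have hξ := measurable_pointMeasure hw.measurable
  have hred (i : ℕ) := (hw.measurable i).prodMk (measurable_reducedPointMeasure hw.measurable i)
  have := Measure.isProbabilityMeasure_map (μ := P) hξ.aemeasurable
  refine (Measure.prod_eq_generateFrom (C := {s | MeasurableSet s})
    (D := piiUnionInter
      (fun s => {t | MeasurableSet[(borel ℝ≥0∞).comap fun μ : Measure I => μ s] t})
      {s | MeasurableSet s}) MeasurableSpace.generateFrom_measurableSet
    (generateFrom_piiUnionInter_measurableSet _ _) MeasurableSpace.isPiSystem_measurableSet
    (isPiSystem_piiUnionInter _ (fun s => @MeasurableSpace.isPiSystem_measurableSet _ (_)) _)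
    ν.toFiniteSpanningSetsIn
    ⟨fun _ => Set.univ, fun _ => ?_, fun _ => measure_lt_top _ _, Set.iUnion_const _⟩ ?_).symm
  · exact ⟨∅, by simp, fun _ => ∅, by simp, by simp⟩
  · rintro A (hA : MeasurableSet A) _ ⟨t, ht, f, hf, rfl⟩
    have ht' : ∀ s ∈ t, MeasurableSet s := fun s hs => ht hs
    have hU : ∀ s ∈ t, ∃ U : Set ℝ≥0∞, MeasurableSet U ∧
        (fun μ : Measure I => μ s) ⁻¹' U = f s := hf
    choose! U hU hUf using hU
    have hB : ⋂ s ∈ t, f s = {μ : Measure I | ∀ s ∈ t, μ s ∈ U s} := by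
      ext μ
      simp only [Set.mem_iInter, Set.mem_ofPred_eq]
      exact forall₂_congr fun s hs => by rw [← hUf s hs, Set.mem_preimage]
    have hBm := measurableSet_forall_apply_mem ht' hU
    rw [hB, Measure.sum_apply _ (hA.prod hBm), Measure.map_apply hξ hBm]
    exact (tsum_congr fun i => Measure.map_apply (hred i) (hA.prod hBm)).trans <|
      hw.tsum_measure_cylinder hA ht' hU

theorem tsum_lintegral_reducedPointMeasure [SigmaFinite ν] [IsProbabilityMeasure P]
    (hw : IsPoissonPointProcess P w ν) {F : I → Measure I → ℝ≥0∞}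
    (hF : Measurable (Function.uncurry F)) :
    ∑' i, ∫⁻ ω, F (w i ω) (reducedPointMeasure (fun j => w j ω) i) ∂P =
      ∫⁻ x, ∫⁻ ω, F x (pointMeasure fun j => w j ω) ∂P ∂ν := by
  have hξ := measurable_pointMeasure hw.measurable
  have hred (i : ℕ) := (hw.measurable i).prodMk (measurable_reducedPointMeasure hw.measurable i)
  have := Measure.isProbabilityMeasure_map (μ := P) hξ.aemeasurable
  calc _ = ∫⁻ p, Function.uncurry F p ∂Measure.sum fun i =>
        P.map fun ω => (w i ω, reducedPointMeasure (fun j => w j ω) i) := by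
        simp_rw [lintegral_sum_measure, lintegral_map hF (hred _), Function.uncurry_apply_pair]
    _ = _ := by
        rw [hw.mecke_equation, lintegral_prod _ hF.aemeasurable]
        refine lintegral_congr fun x => ?_
        exact lintegral_map (hF.comp measurable_prodMk_left) hξ

theorem tsum_lintegral [SigmaFinite ν] [IsProbabilityMeasure P]
    (hw : IsPoissonPointProcess P w ν) {f : I → ℝ≥0∞} (hf : Measurable f) :
    ∑' i, ∫⁻ ω, f (w i ω) ∂P = ∫⁻ x, f x ∂ν := by
  simpa using hw.tsum_lintegral_reducedPointMeasure (F := fun x _ => f x) (hf.comp measurable_fst)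

theorem lintegral_lintegral_pointMeasure [SigmaFinite ν] [IsProbabilityMeasure P]
    (hw : IsPoissonPointProcess P w ν) {f : I → ℝ≥0∞} (hf : Measurable f) :
    ∫⁻ ω, ∫⁻ x, f x ∂(pointMeasure fun j => w j ω) ∂P = ∫⁻ x, f x ∂ν := by
  have hm (i : ℕ) : Measurable fun ω => f (w i ω) := hf.comp (hw.measurable i)
  simp_rw [lintegral_pointMeasure _ hf]
  rw [lintegral_tsum fun i => (hm i).aemeasurable, hw.tsum_lintegral hf]

theorem tsum_tsum_lintegral_mul [SigmaFinite ν] [IsProbabilityMeasure P]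
    (hw : IsPoissonPointProcess P w ν) {f g : I → ℝ≥0∞} (hf : Measurable f) (hg : Measurable g) :
    ∑' i, ∑' j : {j // j ≠ i}, ∫⁻ ω, f (w i ω) * g (w j ω) ∂P =
      (∫⁻ x, f x ∂ν) * ∫⁻ y, g y ∂ν := by
  have hm (i j : ℕ) : Measurable fun ω => f (w i ω) * g (w j ω) :=
    (hf.comp (hw.measurable i)).mul (hg.comp (hw.measurable j))
  calc _ = ∑' i, ∫⁻ ω, f (w i ω) * ∫⁻ y, g y ∂reducedPointMeasure (fun j => w j ω) i ∂P := by
        simp_rw [reducedPointMeasure, lintegral_pointMeasure _ hg, ← ENNReal.tsum_mul_left]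
        exact tsum_congr fun i =>
          (lintegral_tsum fun j : {j // j ≠ i} => (hm i j).aemeasurable).symm
    _ = ∫⁻ x, ∫⁻ ω, f x * ∫⁻ y, g y ∂(pointMeasure fun j => w j ω) ∂P ∂ν :=
        hw.tsum_lintegral_reducedPointMeasure (F := fun x μ => f x * ∫⁻ y, g y ∂μ) <|
          (hf.comp measurable_fst).mul ((Measure.measurable_lintegral hg).comp measurable_snd)
    _ = _ := by
        have hξ : Measurable fun ω => ∫⁻ y, g y ∂(pointMeasure fun j => w j ω) :=
          (Measure.measurable_lintegral hg).comp (measurable_pointMeasure hw.measurable)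
        simp_rw [lintegral_const_mul _ hξ, hw.lintegral_lintegral_pointMeasure hg,
          lintegral_mul_const _ hf]

theorem sum_sum_map_prodMk [SigmaFinite ν] [IsProbabilityMeasure P]
    (hw : IsPoissonPointProcess P w ν) :
    (Measure.sum fun i => Measure.sum fun j : {j // j ≠ i} => P.map fun ω => (w i ω, w j ω)) =
      ν.prod ν := by
  refine (Measure.prod_eq fun A B hA hB => ?_).symm
  have h := hw.tsum_tsum_lintegral_mul (measurable_one.indicator hA) (measurable_one.indicator hB)
  rw [lintegral_indicator_one hA, lintegral_indicator_one hB] at h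
  rw [← h, Measure.sum_apply _ (hA.prod hB)]
  refine tsum_congr fun i => ?_
  rw [Measure.sum_apply _ (hA.prod hB)]
  refine tsum_congr fun j => ?_
  rw [← lintegral_indicator_one (hA.prod hB), lintegral_map (measurable_one.indicator (hA.prod hB))
    ((hw.measurable i).prodMk (hw.measurable j))]
  simp_rw [Set.indicator_prod_one]

theorem tsum_tsum_lintegral [SigmaFinite ν] [IsProbabilityMeasure P]
    (hw : IsPoissonPointProcess P w ν) {h : I × I → ℝ≥0∞} (hh : Measurable h) :
    ∑' i, ∑' j : {j // j ≠ i}, ∫⁻ ω, h (w i ω, w j ω) ∂P = ∫⁻ z, h z ∂(ν.prod ν) := by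
  simp_rw [← hw.sum_sum_map_prodMk, lintegral_sum_measure,
    lintegral_map hh ((hw.measurable _).prodMk (hw.measurable _))]

end IsPoissonPointProcess

end Mecke

section LaplaceFunctional

variable {Ω : Type*} [MeasurableSpace Ω] {P : Measure Ω} {ν : Measure I} {w : ℕ → Ω → I}

theorem lintegral_countMeasure {α : Type*} [Fintype α] [MeasurableSpace α]
    [MeasurableSingletonClass α] (k : α → ℕ∞) (g : α → ℝ≥0∞) :
    ∫⁻ l, g l ∂countMeasure k = ∑ l, g l * k l := by
  simp_rw [countMeasure, lintegral_sum_measure, lintegral_smul_measure, lintegral_dirac,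
    tsum_fintype, smul_eq_mul, mul_comm]

namespace IsPoissonPointProcess

theorem lintegral_expNeg_mul_pointCount [SigmaFinite ν] [IsProbabilityMeasure P]
    (hw : IsPoissonPointProcess P w ν) {A : Set I} (hA : MeasurableSet A) (s : ℝ≥0∞) :
    ∫⁻ ω, expNeg (s * pointCount w A ω) ∂P = expNeg (ν A * (1 - expNeg s)) := by
  rw [← poissonENat.lintegral_expNeg_mul]
  exact (hw.hasLaw_pointCount hA).lintegral_comp (f := fun k : ℕ∞ => expNeg (s * k)) .of_discrete

theorem lintegral_expNeg_fiber [SigmaFinite ν] [IsProbabilityMeasure P]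
    (hw : IsPoissonPointProcess P w ν) {α : Type*} [Finite α] [MeasurableSpace α]
    [MeasurableSingletonClass α] {a : I → α} (ha : Measurable a) (g : α → ℝ≥0∞) :
    ∫⁻ ω, expNeg (∫⁻ x, g (a x) ∂(pointMeasure fun i => w i ω)) ∂P =
      expNeg (∫⁻ x, (1 - expNeg (g (a x))) ∂ν) := by
  have := Fintype.ofFinite α
  have hfiber (l : α) : MeasurableSet (a ⁻¹' {l}) := ha (measurableSet_singleton l)
  have hm (l : α) : Measurable fun k : ℕ∞ => expNeg (g l * k) := .of_discrete
  calc _ = ∫⁻ ω, ∏ l, expNeg (g l * pointCount w (a ⁻¹' {l}) ω) ∂P := by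
        simp_rw [← lintegral_map (f := g) .of_discrete ha, map_pointMeasure _ ha,
          pointMeasure_eq_countMeasure, lintegral_countMeasure, expNeg.apply_sum]
        rfl
    _ = ∏ l, expNeg (ν (a ⁻¹' {l}) * (1 - expNeg (g l))) := by
        simp_rw [← hw.lintegral_expNeg_mul_pointCount (hfiber _)]
        exact lintegral_prod_eq_prod_lintegral_of_indepFun _ _
          ((hw.iIndepFun_pointCount_fiber ha).comp _ hm)
          fun l => (hm l).comp (measurable_pointCount hw.measurable (hfiber l))
    _ = _ := by
        rw [← expNeg.apply_sum, ← lintegral_map (f := fun l => 1 - expNeg (g l)) .of_discrete ha,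
          lintegral_fintype]
        simp_rw [Measure.map_apply ha (measurableSet_singleton _), mul_comm]

theorem lintegral_expNeg [SigmaFinite ν] [IsProbabilityMeasure P]
    (hw : IsPoissonPointProcess P w ν) {f : I → ℝ≥0∞} (hf : Measurable f) :
    ∫⁻ ω, expNeg (∫⁻ x, f x ∂(pointMeasure fun i => w i ω)) ∂P =
      expNeg (∫⁻ x, (1 - expNeg (f x)) ∂ν) := by
  have hξ := measurable_pointMeasure hw.measurable
  let φ := SimpleFunc.eapprox f
  have hmono (x : I) : Monotone fun m => φ m x := fun _ _ h => SimpleFunc.monotone_eapprox f h x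
  have hφ (x : I) : Tendsto (fun m => φ m x) atTop (𝓝 (f x)) :=
    SimpleFunc.iSup_eapprox_apply hf x ▸ tendsto_atTop_iSup (hmono x)
  have hsimple (m : ℕ) : ∫⁻ ω, expNeg (∫⁻ x, φ m x ∂(pointMeasure fun i => w i ω)) ∂P =
      expNeg (∫⁻ x, (1 - expNeg (φ m x)) ∂ν) :=
    hw.lintegral_expNeg_fiber (a := fun x => (⟨φ m x, (φ m).mem_range_self x⟩ : (φ m).range))
      (φ m).measurable.subtype_mk Subtype.val
  have hleft : Tendsto (fun m => ∫⁻ ω, expNeg (∫⁻ x, φ m x ∂(pointMeasure fun i => w i ω)) ∂P)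
      atTop (𝓝 (∫⁻ ω, expNeg (∫⁻ x, f x ∂(pointMeasure fun i => w i ω)) ∂P)) := by
    refine tendsto_lintegral_of_dominated_convergence 1 (fun m => ?_)
      (fun m => .of_forall fun ω => expNeg.apply_le_one _) (by simp) (.of_forall fun ω => ?_)
    · exact expNeg.continuous.measurable.comp
        ((Measure.measurable_lintegral (φ m).measurable).comp hξ)
    · exact (expNeg.continuous.tendsto _).comp <| lintegral_tendsto_of_tendsto_of_monotone
        (fun m => (φ m).measurable.aemeasurable) (.of_forall hmono) (.of_forall hφ)
  have hright : Tendsto (fun m => expNeg (∫⁻ x, (1 - expNeg (φ m x)) ∂ν)) atTop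
      (𝓝 (expNeg (∫⁻ x, (1 - expNeg (f x)) ∂ν))) := by
    refine (expNeg.continuous.tendsto _).comp <| lintegral_tendsto_of_tendsto_of_monotone
      (fun m => ?_) (.of_forall fun x m m' h => ?_) (.of_forall fun x => ?_)
    · exact (measurable_const.sub
        (expNeg.continuous.measurable.comp (φ m).measurable)).aemeasurable
    · exact tsub_le_tsub_left (expNeg.antitone (hmono x h)) 1
    · exact ENNReal.Tendsto.sub tendsto_const_nhds ((expNeg.continuous.tendsto _).comp (hφ x))
        (.inl ENNReal.one_ne_top)
  simp_rw [hsimple] at hleft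
  exact tendsto_nhds_unique hleft hright

end IsPoissonPointProcess

end LaplaceFunctional

/-- The power series of `-log (1 - t)`, equal to `∞` for `t ≥ 1`. For bilinear `t` it exhibits
`-log (1 - t)` as a sum of products of functions of the two factors. -/
noncomputable def negLogOneSub (t : ℝ≥0∞) : ℝ≥0∞ := ∑' k : ℕ, t ^ (k + 1) / (k + 1)

namespace negLogOneSub

@[simp] theorem apply_zero : negLogOneSub 0 = 0 := by simp [negLogOneSub]

theorem apply_one : negLogOneSub 1 = ∞ := by
  have h (k : ℕ) : (1 : ℝ≥0∞) ^ (k + 1) / (k + 1) = (((k + 1 : ℕ) : NNReal)⁻¹ : NNReal) := by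
    rw [one_pow, one_div, ENNReal.coe_inv (by positivity), ENNReal.coe_natCast, Nat.cast_succ]
  simp_rw [negLogOneSub, h]
  rw [ENNReal.tsum_coe_eq_top_iff_not_summable_coe]
  simpa using mt (summable_nat_add_iff (f := fun k : ℕ => (k : ℝ)⁻¹) 1).1
    Real.not_summable_natCast_inv

theorem apply_ofReal {x : ℝ} (h0 : 0 ≤ x) (h1 : x < 1) :
    negLogOneSub (ENNReal.ofReal x) = ENNReal.ofReal (-Real.log (1 - x)) := by
  have h := Real.hasSum_pow_div_log_of_abs_lt_one (abs_lt.2 ⟨by linarith, h1⟩)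
  rw [negLogOneSub, ← h.tsum_eq, ENNReal.ofReal_tsum_of_nonneg (fun k => by positivity) h.summable]
  refine tsum_congr fun k => ?_
  rw [ENNReal.ofReal_div_of_pos (by positivity), ENNReal.ofReal_pow h0]
  norm_cast

theorem measurable : Measurable negLogOneSub :=
  .tsum fun k => by fun_prop

theorem measurable_lintegral_mul {X : Type*} [MeasurableSpace X] {g : X → ℝ≥0∞}
    (hg : Measurable g) :
    Measurable fun p : ℝ≥0∞ × Measure X => ∫⁻ y, negLogOneSub (p.1 * g y) ∂p.2 := by
  have h (p : ℝ≥0∞ × Measure X) : ∫⁻ y, negLogOneSub (p.1 * g y) ∂p.2 =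
      ∑' k : ℕ, p.1 ^ (k + 1) / (k + 1) * ∫⁻ y, g y ^ (k + 1) ∂p.2 := by
    simp_rw [negLogOneSub]
    rw [lintegral_tsum fun k => by fun_prop]
    refine tsum_congr fun k => ?_
    rw [← lintegral_const_mul _ (hg.pow_const _)]
    simp_rw [mul_pow, ENNReal.mul_div_right_comm]
  simp_rw [h]
  refine .tsum fun k => .mul (by fun_prop) ?_
  exact (Measure.measurable_lintegral (hg.pow_const _)).comp measurable_snd

end negLogOneSub

theorem expNeg_negLogOneSub {x : ℝ} (h0 : 0 ≤ x) (h1 : x ≤ 1) :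
    expNeg (negLogOneSub (ENNReal.ofReal x)) = ENNReal.ofReal (1 - x) := by
  rcases h1.eq_or_lt with rfl | h1
  · simp [negLogOneSub.apply_one]
  · rw [negLogOneSub.apply_ofReal h0 h1, expNeg.apply_ofReal, neg_neg, Real.exp_log (by linarith)]
    exact neg_nonneg.2 (Real.log_nonpos (by linarith) (by linarith))

theorem expNeg_natCast_mul_negLogOneSub (n : ℕ) (p : I) :
    expNeg (n * negLogOneSub (ENNReal.ofReal p)) = ENNReal.ofReal ((1 - p) ^ n) := by
  rw [expNeg.apply_natCast_mul, expNeg_negLogOneSub p.2.1 p.2.2,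
    ENNReal.ofReal_pow (sub_nonneg.2 p.2.2)]

theorem measurable_binomial (n : ℕ) : Measurable fun p : I => binomial n p := by
  refine Measure.measurable_of_measurable_coe _ fun s _ => ?_
  simp_rw [binomial_eq_sum_dirac, Measure.finsetSum_apply, Measure.smul_apply]
  fun_prop

theorem binomial_zero_right (n : ℕ) : binomial n 0 = Measure.dirac 0 := by
  refine Measure.ext_of_singleton fun k => ?_
  rcases k with _ | k <;> simp [binomial_singleton]

theorem lintegral_natCast_binomial (n : ℕ) (p : I) :
    ∫⁻ k : ℕ, (k : ℝ≥0∞) ∂(binomial n p) = ENNReal.ofReal (n * p) := by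
  have h : ∫ k : ℕ, (k : ℝ) ∂(binomial n p) = n * p := by
    have hb := congrArg (Polynomial.eval (p : ℝ)) (bernsteinPolynomial.sum_smul ℝ n)
    simp only [Polynomial.eval_finsetSum, bernsteinPolynomial, nsmul_eq_mul, Polynomial.eval_mul,
      Polynomial.eval_natCast, Polynomial.eval_pow, Polynomial.eval_X, Polynomial.eval_sub,
      Polynomial.eval_one] at hb
    rw [integral_binomial, ← hb, Nat.range_succ_eq_Iic]
    exact Finset.sum_congr rfl fun k _ => by rw [smul_eq_mul, mul_comm]
  rw [← h, ofReal_integral_eq_lintegral_ofReal (integrable_binomial _)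
    (.of_forall fun k => Nat.cast_nonneg k)]
  simp

theorem binomial_singleton_zero (n : ℕ) (p : I) :
    binomial n p {0} = ENNReal.ofReal ((1 - p) ^ n) := by
  rw [← ofReal_measureReal, binomial_real_zero]

theorem lintegral_indicator_pos_binomial (n : ℕ) (p : I) :
    ∫⁻ k : ℕ, ((if 0 < k then 1 else 0 : ℕ) : ℝ≥0∞) ∂(binomial n p) =
      ENNReal.ofReal (1 - (1 - p) ^ n) := by
  have h (k : ℕ) : ((if 0 < k then 1 else 0 : ℕ) : ℝ≥0∞) = Set.indicator {0}ᶜ 1 k := by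
    rcases k.eq_zero_or_pos with rfl | hk <;> simp [*, Nat.pos_iff_ne_zero.1]
  simp_rw [h]
  rw [lintegral_indicator_one .of_discrete, prob_compl_eq_one_sub .of_discrete,
    binomial_singleton_zero, ENNReal.ofReal_sub _ (pow_nonneg (sub_nonneg.2 p.2.2) n),
    ENNReal.ofReal_one]

theorem edgeRate_mk (w : ℕ → I) (i j : ℕ) :
    edgeRate w s(i, j) = if i = j then 0 else w i * w j := rfl

theorem activeVertices_binaryGraph (G : Sym2 ℕ → ℕ) :
    activeVertices (binaryGraph G) = activeVertices G := by
  ext i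
  simp only [activeVertices, binaryGraph, Set.mem_ofPred_eq]
  refine exists_congr fun j => ?_
  split_ifs with h <;> simp [h]

section EdgeMultiplicity

variable {Ω : Type*} [MeasurableSpace Ω] {P : Measure Ω}
  {w : ℕ → Ω → I} {n : ℕ} {M : Sym2 ℕ → Ω → ℕ}

theorem measurable_edgeRate (hw : ∀ i, Measurable (w i)) (e : Sym2 ℕ) :
    Measurable fun ω => edgeRate (fun i => w i ω) e := by
  induction e with | _ i j
  simp_rw [edgeRate_mk]
  split_ifs
  · exact measurable_const
  · exact (continuous_mul.measurable (α := I × I)).comp ((hw i).prodMk (hw j))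

namespace IsEdgeMultiplicity

theorem measure_forall_eq [IsProbabilityMeasure P] (hM : IsEdgeMultiplicity P w n M)
    (hw : ∀ i, Measurable (w i)) (S : Finset (Sym2 ℕ)) (k : Sym2 ℕ → ℕ) :
    P {ω | ∀ e ∈ S, M e ω = k e} =
      ∫⁻ ω, ∏ e ∈ S, binomial n (edgeRate (fun i => w i ω) e) {k e} ∂P := by
  have hset : MeasurableSet {ω | ∀ e ∈ S, M e ω = k e} := by
    simp_rw [Set.ofPred_forall]
    exact S.measurableSet_biInter fun e _ => hM.measurable e (measurableSet_singleton _)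
  have hmeas : Measurable fun ω =>
      ∏ e ∈ S, (binomial n (edgeRate (fun i => w i ω) e)).real {k e} :=
    S.measurable_prod fun e _ => ((Measure.measurable_coe (measurableSet_singleton _)).comp
      ((measurable_binomial n).comp (measurable_edgeRate hw e))).ennreal_toReal
  have hreal : P.real {ω | ∀ e ∈ S, M e ω = k e} =
      ∫ ω, ∏ e ∈ S, (binomial n (edgeRate (fun i => w i ω) e)).real {k e} ∂P := by
    rw [← integral_congr_ae (hM.condLaw S k),
      integral_condExp (measurable_pi_lambda _ hw).comap_le]
    exact (integral_indicator_one hset).symm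
  rw [← ofReal_measureReal, hreal, ofReal_integral_eq_lintegral_ofReal
    (.of_bound hmeas.aestronglyMeasurable 1 <| .of_forall fun ω => ?_)
    (.of_forall fun ω => Finset.prod_nonneg fun _ _ => measureReal_nonneg)]
  · refine lintegral_congr fun ω => ?_
    rw [ENNReal.ofReal_prod_of_nonneg fun _ _ => measureReal_nonneg]
    exact Finset.prod_congr rfl fun _ _ => ofReal_measureReal
  · rw [Real.norm_of_nonneg (Finset.prod_nonneg fun _ _ => measureReal_nonneg)]
    exact Finset.prod_le_one (fun _ _ => measureReal_nonneg) fun _ _ => measureReal_le_one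

theorem lintegral_comp [IsProbabilityMeasure P] (hM : IsEdgeMultiplicity P w n M)
    (hw : ∀ i, Measurable (w i)) (e : Sym2 ℕ) (f : ℕ → ℝ≥0∞) :
    ∫⁻ ω, f (M e ω) ∂P =
      ∫⁻ ω, ∫⁻ k, f k ∂(binomial n (edgeRate (fun i => w i ω) e)) ∂P := by
  have hB : Measurable fun ω => binomial n (edgeRate (fun i => w i ω) e) :=
    (measurable_binomial n).comp (measurable_edgeRate hw e)
  have hlaw : P.map (M e) = P.bind fun ω => binomial n (edgeRate (fun i => w i ω) e) := by
    refine Measure.ext_of_singleton fun k => ?_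
    rw [Measure.map_apply (hM.measurable e) (measurableSet_singleton k),
      Measure.bind_apply (measurableSet_singleton k) hB.aemeasurable]
    simpa [Set.preimage] using hM.measure_forall_eq hw {e} fun _ => k
  rw [← lintegral_map .of_discrete (hM.measurable e), hlaw,
    Measure.lintegral_bind hB.aemeasurable Measurable.of_discrete.aemeasurable]

theorem measure_forall_eq_zero [IsProbabilityMeasure P] (hM : IsEdgeMultiplicity P w n M)
    (hw : ∀ i, Measurable (w i)) {ι : Type*} [Countable ι] {s : ι → Sym2 ℕ}
    (hs : Function.Injective s) :
    P {ω | ∀ j, M (s j) ω = 0} = ∫⁻ ω, expNeg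
      (∑' j, n * negLogOneSub (ENNReal.ofReal (edgeRate (fun i => w i ω) (s j)))) ∂P := by
  have hmeas (j : ι) : Measurable fun ω =>
      n * negLogOneSub (ENNReal.ofReal (edgeRate (fun i => w i ω) (s j))) :=
    .const_mul (negLogOneSub.measurable.comp
      (measurable_subtype_coe.comp (measurable_edgeRate hw _)).ennreal_ofReal) _
  have hfin (S : Finset ι) : P (⋂ j ∈ S, M (s j) ⁻¹' {0}) = ∫⁻ ω, expNeg
      (∑ j ∈ S, n * negLogOneSub (ENNReal.ofReal (edgeRate (fun i => w i ω) (s j)))) ∂P := by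
    have hset : ⋂ j ∈ S, M (s j) ⁻¹' {0} = {ω | ∀ e ∈ S.map ⟨s, hs⟩, M e ω = 0} := by
      ext; simp
    rw [hset, hM.measure_forall_eq hw _ fun _ => 0]
    simp_rw [Finset.prod_map, Function.Embedding.coeFn_mk, binomial_singleton_zero,
      ← expNeg_natCast_mul_negLogOneSub, expNeg.apply_sum]
  have hset : {ω | ∀ j, M (s j) ω = 0} = ⋂ S : Finset ι, ⋂ j ∈ S, M (s j) ⁻¹' {0} := by
    ext ω
    simp only [Set.mem_ofPred_eq, Set.mem_iInter, Set.mem_preimage, Set.mem_singleton_iff]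
    exact ⟨fun h _ j _ => h j, fun h j => h {j} j (Finset.mem_singleton_self j)⟩
  have hleft : Tendsto (fun S : Finset ι => P (⋂ j ∈ S, M (s j) ⁻¹' {0})) atTop
      (𝓝 (P {ω | ∀ j, M (s j) ω = 0})) := by
    rw [hset]
    exact tendsto_measure_iInter_atTop (fun S => (S.measurableSet_biInter fun j _ =>
      hM.measurable (s j) (measurableSet_singleton 0)).nullMeasurableSet)
      (fun S T h => Set.biInter_subset_biInter_left h) ⟨∅, measure_ne_top _ _⟩
  simp_rw [hfin] at hleft
  refine tendsto_nhds_unique hleft <| tendsto_lintegral_filter_of_dominated_convergence 1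
    (.of_forall fun S => expNeg.continuous.measurable.comp (S.measurable_sum fun j _ => hmeas j))
    (.of_forall fun S => .of_forall fun ω => expNeg.apply_le_one _) (by simp)
    (.of_forall fun ω => (expNeg.continuous.tendsto _).comp ENNReal.summable.hasSum)

end IsEdgeMultiplicity

end EdgeMultiplicity

section Vertices

theorem vertexCount_eq_tsum (G : Sym2 ℕ → ℕ) :
    vertexCount G = ∑' i, (activeVertices G).indicator 1 i := by
  rw [← tsum_subtype, Pi.one_def, ENNReal.tsum_set_one]
  rfl

/-- The product `∏ (1 - x y)ⁿ` over the points `y` of the point measure `μ`, which is the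
probability that a vertex of weight `x` has no edge to the vertices with weights `μ`. -/
noncomputable def isolationProb (n : ℕ) (x : I) (μ : Measure I) : ℝ≥0∞ :=
  expNeg (∫⁻ y, n * negLogOneSub (ENNReal.ofReal (x * y : I)) ∂μ)

theorem isolationProb_le_one (n : ℕ) (x : I) (μ : Measure I) : isolationProb n x μ ≤ 1 :=
  expNeg.apply_le_one _

theorem measurable_isolationProb (n : ℕ) : Measurable (Function.uncurry (isolationProb n)) := by
  have h := (negLogOneSub.measurable_lintegral_mul (g := fun y : I => ENNReal.ofReal y)
    (by fun_prop)).comp (f := fun p : I × Measure I => (ENNReal.ofReal p.1, p.2)) (by fun_prop)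
  have hmul (x y : I) : ENNReal.ofReal (x * y : I) = ENNReal.ofReal x * ENNReal.ofReal y :=
    ENNReal.ofReal_mul x.2.1
  refine expNeg.continuous.measurable.comp ?_
  simpa only [Function.comp_def, hmul, lintegral_const_mul' _ _ (ENNReal.natCast_ne_top n)]
    using h.const_mul (n : ℝ≥0∞)

theorem measurable_natCast_mul_negLogOneSub (n : ℕ) (x : I) :
    Measurable fun y : I => n * negLogOneSub (ENNReal.ofReal (x * y : I)) :=
  .const_mul (negLogOneSub.measurable.comp (by fun_prop)) _

theorem expNeg_tsum_negLogOneSub_edgeRate (w : ℕ → I) (n i : ℕ) :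
    expNeg (∑' j, n * negLogOneSub (ENNReal.ofReal (edgeRate w s(i, j)))) =
      isolationProb n (w i) (reducedPointMeasure w i) := by
  rw [isolationProb, reducedPointMeasure,
    lintegral_pointMeasure _ (measurable_natCast_mul_negLogOneSub n (w i)),
    ← tsum_subtype_eq_of_support_subset (s := {j | j ≠ i})]
  · refine congrArg expNeg (tsum_congr fun j => ?_)
    rw [edgeRate_mk, if_neg j.2.symm]
  · rintro j hj rfl
    simp [edgeRate_mk] at hj

theorem lintegral_one_sub {Ω : Type*} [MeasurableSpace Ω] {P : Measure Ω}
    [IsProbabilityMeasure P] {f : Ω → ℝ≥0∞} (hf : Measurable f) (h : ∀ ω, f ω ≤ 1) :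
    ∫⁻ ω, (1 - f ω) ∂P = 1 - ∫⁻ ω, f ω ∂P := by
  have hle : ∫⁻ ω, f ω ∂P ≤ 1 := (lintegral_mono h).trans_eq (by simp)
  rw [lintegral_sub hf (ne_top_of_le_ne_top ENNReal.one_ne_top hle) (.of_forall h), lintegral_one,
    measure_univ]

variable {Ω : Type*} [MeasurableSpace Ω] {P : Measure Ω} {w : ℕ → Ω → I} {n : ℕ}
  {M : Sym2 ℕ → Ω → ℕ}

theorem IsEdgeMultiplicity.measurableSet_mem_activeVertices (hM : IsEdgeMultiplicity P w n M)
    (i : ℕ) : MeasurableSet {ω | i ∈ activeVertices fun e => M e ω} := by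
  simp_rw [activeVertices, Set.mem_ofPred_eq, Set.ofPred_exists]
  exact .iUnion fun j => measurableSet_lt measurable_const (hM.measurable _)

theorem IsEdgeMultiplicity.measurable_vertexCount (hM : IsEdgeMultiplicity P w n M) :
    Measurable fun ω => vertexCount fun e => M e ω := by
  simp_rw [vertexCount_eq_tsum]
  exact .tsum fun i => measurable_one.indicator (hM.measurableSet_mem_activeVertices i)

variable [IsProbabilityMeasure P]

theorem IsEdgeMultiplicity.measure_mem_activeVertices
    (hM : IsEdgeMultiplicity P w n M) (hw : ∀ i, Measurable (w i)) (i : ℕ) :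
    P {ω | i ∈ activeVertices fun e => M e ω} =
      ∫⁻ ω, (1 - isolationProb n (w i ω) (reducedPointMeasure (fun j => w j ω) i)) ∂P := by
  have hcompl : {ω | i ∈ activeVertices fun e => M e ω}ᶜ = {ω | ∀ j, M s(i, j) ω = 0} := by
    ext ω
    simp [activeVertices]
  have hmeas := (hM.measurableSet_mem_activeVertices i).compl
  have hiso : Measurable fun ω =>
      isolationProb n (w i ω) (reducedPointMeasure (fun j => w j ω) i) :=
    (measurable_isolationProb n).comp ((hw i).prodMk (measurable_reducedPointMeasure hw i))
  rw [lintegral_one_sub hiso fun ω => isolationProb_le_one _ _ _,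
    ← compl_compl {ω | _}, prob_compl_eq_one_sub hmeas, hcompl,
    hM.measure_forall_eq_zero hw (s := fun j => s(i, j)) fun _ _ => Sym2.congr_right.1]
  simp_rw [expNeg_tsum_negLogOneSub_edgeRate]

variable {ν : Measure I} [SigmaFinite ν]

theorem IsPoissonPointProcess.lintegral_one_sub_isolationProb (hw : IsPoissonPointProcess P w ν)
    (n : ℕ) (x : I) : ∫⁻ ω, (1 - isolationProb n x (pointMeasure fun j => w j ω)) ∂P =
      1 - expNeg (∫⁻ y : I, ENNReal.ofReal (1 - (1 - x * y) ^ n) ∂ν) := by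
  have hiso : Measurable fun ω => isolationProb n x (pointMeasure fun j => w j ω) :=
    ((measurable_isolationProb n).comp measurable_prodMk_left).comp
      (measurable_pointMeasure hw.measurable)
  rw [lintegral_one_sub hiso fun ω => isolationProb_le_one _ _ _]
  simp_rw [isolationProb]
  rw [hw.lintegral_expNeg (measurable_natCast_mul_negLogOneSub n x)]
  congr! 4 with y
  rw [expNeg_natCast_mul_negLogOneSub, ← ENNReal.ofReal_one,
    ← ENNReal.ofReal_sub _ (pow_nonneg (sub_nonneg.2 (x * y).2.2) n), Set.Icc.coe_mul]

theorem IsPoissonPointProcess.lintegral_vertexCount (hw : IsPoissonPointProcess P w ν)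
    (hM : IsEdgeMultiplicity P w n M) :
    ∫⁻ ω, vertexCount (fun e => M e ω) ∂P =
      ∫⁻ x : I, (1 - expNeg (∫⁻ y : I, ENNReal.ofReal (1 - (1 - x * y) ^ n) ∂ν)) ∂ν :=
  calc _ = ∑' i, P {ω | i ∈ activeVertices fun e => M e ω} := by
        simp_rw [vertexCount_eq_tsum,
          ← lintegral_indicator_one (hM.measurableSet_mem_activeVertices _)]
        exact lintegral_tsum fun i =>
          (measurable_one.indicator (hM.measurableSet_mem_activeVertices i)).aemeasurable
    _ = ∑' i, ∫⁻ ω, (1 - isolationProb n (w i ω) (reducedPointMeasure (fun j => w j ω) i)) ∂P :=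
        tsum_congr (hM.measure_mem_activeVertices hw.measurable)
    _ = ∫⁻ x, ∫⁻ ω, (1 - isolationProb n x (pointMeasure fun j => w j ω)) ∂P ∂ν :=
        hw.tsum_lintegral_reducedPointMeasure (F := fun x μ => 1 - isolationProb n x μ)
          (.sub measurable_const (measurable_isolationProb n))
    _ = _ := lintegral_congr (hw.lintegral_one_sub_isolationProb n)

end Vertices

section Edges

theorem two_mul_tsum_sym2 {α : Type*} (f : Sym2 α → ℝ≥0∞)
    (hf : ∀ i, f s(i, i) = 0) :
    2 * ∑' e, f e = ∑' i, ∑' j : {j // j ≠ i}, f s(i, j) := by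
  classical
  have h (i : α) : ∑' j : {j // j ≠ i}, f s(i, j) = ∑' j, f s(i, j) :=
    tsum_subtype_eq_of_support_subset (f := fun j => f s(i, j)) fun j hj => by
      rintro rfl
      exact hj (hf j)
  simp_rw [h]
  rw [← ENNReal.tsum_prod (f := fun i j => f s(i, j)),
    ← ENNReal.tsum_fiberwise (fun p : α × α => f s(p.1, p.2)) fun p => s(p.1, p.2),
    ← ENNReal.tsum_mul_left]
  refine tsum_congr fun e => ?_
  have hfib (p : (fun p : α × α => s(p.1, p.2)) ⁻¹' {e}) :
      f s((p : α × α).1, (p : α × α).2) = f e := congrArg f p.2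
  simp_rw [hfib]
  rw [ENNReal.tsum_set_const]
  induction e with | _ i j
  rcases eq_or_ne i j with rfl | hij
  · simp [hf]
  · have hset : (fun p : α × α => s(p.1, p.2)) ⁻¹' {s(i, j)} = {(i, j), (j, i)} := by
      ext ⟨a, b⟩
      simp
    rw [hset, Set.encard_pair (by simp [hij])]
    rfl

variable {Ω : Type*} [MeasurableSpace Ω] {P : Measure Ω} {w : ℕ → Ω → I} {n : ℕ}
  {M : Sym2 ℕ → Ω → ℕ}

theorem measurable_edgeCount {X : Sym2 ℕ → Ω → ℕ} (hX : ∀ e, Measurable (X e)) :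
    Measurable fun ω => edgeCount fun e => X e ω :=
  .tsum fun e => (Measurable.of_discrete (f := fun k : ℕ => (k : ℝ≥0∞))).comp (hX e)

theorem IsPoissonPointProcess.two_mul_lintegral_tsum_edge [IsProbabilityMeasure P]
    {ν : Measure I} [SigmaFinite ν] (hw : IsPoissonPointProcess P w ν)
    (hM : IsEdgeMultiplicity P w n M) {f : ℕ → ℝ≥0∞} (hf : f 0 = 0) :
    2 * ∫⁻ ω, ∑' e, f (M e ω) ∂P =
      ∫⁻ z, ∫⁻ k, f k ∂(binomial n (z.1 * z.2)) ∂(ν.prod ν) := by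
  have hm (e : Sym2 ℕ) : Measurable fun ω => f (M e ω) :=
    Measurable.of_discrete.comp (hM.measurable e)
  have hbinomial : Measurable fun z : I × I => ∫⁻ k, f k ∂(binomial n (z.1 * z.2)) :=
    (Measure.measurable_lintegral .of_discrete).comp ((measurable_binomial n).comp (by fun_prop))
  have hloop (i : ℕ) :
      ∫⁻ ω, ∫⁻ k, f k ∂(binomial n (edgeRate (fun i => w i ω) s(i, i))) ∂P = 0 := by
    simp [edgeRate_mk, binomial_zero_right, hf]
  rw [lintegral_tsum fun e => (hm e).aemeasurable]
  simp_rw [hM.lintegral_comp hw.measurable]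
  rw [two_mul_tsum_sym2 _ hloop, ← hw.tsum_tsum_lintegral hbinomial]
  refine tsum_congr fun i => tsum_congr fun j => ?_
  simp_rw [edgeRate_mk, if_neg j.2.symm]

end Edges

theorem one_sub_one_sub_pow_nonneg (n : ℕ) (p : I) : 0 ≤ 1 - (1 - (p : ℝ)) ^ n :=
  sub_nonneg.2 (pow_le_one₀ (sub_nonneg.2 p.2.2) (sub_le_self _ p.2.1))

section Expectations

variable {α Ω : Type*} [MeasurableSpace α] [MeasurableSpace Ω] {μ : Measure α} {P : Measure Ω}

theorem integrable_one_sub_one_sub_pow (n : ℕ) {g : α → ℝ} (hg : Integrable g μ)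
    (h01 : ∀ a, g a ∈ Set.Icc 0 1) : Integrable (fun a => 1 - (1 - g a) ^ n) μ := by
  refine (hg.const_mul (n : ℝ)).mono' (by fun_prop) (.of_forall fun a => ?_)
  rw [Real.norm_of_nonneg (one_sub_one_sub_pow_nonneg n ⟨g a, h01 a⟩)]
  have h := one_add_mul_le_pow (a := -g a) (by linarith [(h01 a).2]) n
  rw [← sub_eq_add_neg] at h
  linarith

theorem integrable_one_sub_exp_neg {g : α → ℝ} (hg : Integrable g μ) (h0 : ∀ a, 0 ≤ g a) :
    Integrable (fun a => 1 - Real.exp (-g a)) μ := by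
  refine hg.mono' (by fun_prop) (.of_forall fun a => ?_)
  rw [Real.norm_of_nonneg (sub_nonneg.2 (Real.exp_le_one_iff.2 (neg_nonpos.2 (h0 a))))]
  linarith [Real.add_one_le_exp (-g a)]

theorem HasExpectation.of_two_mul_lintegral_eq {X : Ω → ℝ≥0∞} (hX : Measurable X) {φ : α → ℝ}
    (hφ : Integrable φ μ) (h0 : ∀ a, 0 ≤ φ a)
    (h : 2 * ∫⁻ ω, X ω ∂P = ∫⁻ a, ENNReal.ofReal (φ a) ∂μ) :
    HasExpectation P X (1 / 2 * ∫ a, φ a ∂μ) := by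
  refine ⟨hX.aemeasurable, mul_nonneg (by norm_num) (integral_nonneg h0), ?_⟩
  rw [ENNReal.ofReal_mul (by norm_num), ofReal_integral_eq_lintegral_ofReal hφ (.of_forall h0), ← h,
    ← mul_assoc, one_div, ENNReal.ofReal_inv_of_pos two_pos, ENNReal.ofReal_ofNat,
    ENNReal.inv_mul_cancel (by simp) (by simp), one_mul]

variable [IsProbabilityMeasure P] {ν : Measure I} [SigmaFinite ν] {w : ℕ → Ω → I} {n : ℕ}
  {M : Sym2 ℕ → Ω → ℕ}

namespace IsPoissonPointProcess

theorem hasExpectation_vertexCount (hw : IsPoissonPointProcess P w ν)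
    (hM : IsEdgeMultiplicity P w n M)
    (hint : ∀ x : I, Integrable (fun y : I => 1 - (1 - (x : ℝ) * y) ^ n) ν)
    (hint' : Integrable
      (fun x : I => 1 - Real.exp (-∫ y : I, (1 - (1 - (x : ℝ) * y) ^ n) ∂ν)) ν) :
    HasExpectation P (fun ω => vertexCount fun e => M e ω)
      (∫ x : I, (1 - Real.exp (-∫ y : I, (1 - (1 - (x : ℝ) * y) ^ n) ∂ν)) ∂ν) := by
  have h0 (x : I) : 0 ≤ ∫ y : I, (1 - (1 - (x : ℝ) * y) ^ n) ∂ν :=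
    integral_nonneg fun y => one_sub_one_sub_pow_nonneg n (x * y)
  have h0' (x : I) : 0 ≤ 1 - Real.exp (-∫ y : I, (1 - (1 - (x : ℝ) * y) ^ n) ∂ν) :=
    sub_nonneg.2 (Real.exp_le_one_iff.2 (neg_nonpos.2 (h0 x)))
  refine ⟨hM.measurable_vertexCount.aemeasurable, integral_nonneg h0', ?_⟩
  rw [hw.lintegral_vertexCount hM, ofReal_integral_eq_lintegral_ofReal hint' (.of_forall h0')]
  refine lintegral_congr fun x => ?_
  rw [← ofReal_integral_eq_lintegral_ofReal (hint x)
    (.of_forall fun y => one_sub_one_sub_pow_nonneg n (x * y)), expNeg.apply_ofReal (h0 x),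
    ENNReal.ofReal_sub _ (Real.exp_pos _).le, ENNReal.ofReal_one]

theorem hasExpectation_edgeCount (hw : IsPoissonPointProcess P w ν)
    (hM : IsEdgeMultiplicity P w n M)
    (hint : Integrable (fun p : I × I => (p.1 : ℝ) * p.2) (ν.prod ν)) :
    HasExpectation P (fun ω => edgeCount fun e => M e ω)
      ((n : ℝ) / 2 * ∫ v : I, ∫ w : I, (w : ℝ) * v ∂ν ∂ν) := by
  have h := HasExpectation.of_two_mul_lintegral_eq (measurable_edgeCount hM.measurable)
    (hint.const_mul (n : ℝ)) (fun p => mul_nonneg n.cast_nonneg (p.1 * p.2).2.1) <| by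
      simpa only [edgeCount, lintegral_natCast_binomial, Set.Icc.coe_mul] using
        hw.two_mul_lintegral_tsum_edge hM (f := fun k => k) Nat.cast_zero
  rwa [integral_const_mul, integral_prod_symm _ hint, ← mul_assoc, one_div_mul_eq_div] at h

theorem hasExpectation_edgeCount_binaryGraph (hw : IsPoissonPointProcess P w ν)
    (hM : IsEdgeMultiplicity P w n M)
    (hint : Integrable (fun p : I × I => 1 - (1 - (p.1 : ℝ) * p.2) ^ n) (ν.prod ν)) :
    HasExpectation P (fun ω => edgeCount (binaryGraph fun e => M e ω))
      ((1 : ℝ) / 2 * ∫ v : I, ∫ w : I, (1 - (1 - (w : ℝ) * v) ^ n) ∂ν ∂ν) := by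
  have hmeas (e : Sym2 ℕ) : Measurable fun ω => binaryGraph (fun e => M e ω) e :=
    (Measurable.of_discrete (f := fun k : ℕ => if 0 < k then 1 else 0)).comp (hM.measurable e)
  rw [← integral_prod_symm _ hint]
  refine .of_two_mul_lintegral_eq (measurable_edgeCount hmeas) hint
    (fun p => one_sub_one_sub_pow_nonneg n (p.1 * p.2)) ?_
  simpa only [edgeCount, binaryGraph, lintegral_indicator_pos_binomial, Set.Icc.coe_mul] using
    hw.two_mul_lintegral_tsum_edge hM
      (f := fun k => ((if 0 < k then 1 else 0 : ℕ) : ℝ≥0∞)) (by simp)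

end IsPoissonPointProcess

end Expectations

theorem lemma2_general {Ω : Type*} [MeasurableSpace Ω] (P : Measure Ω) [IsProbabilityMeasure P]
    (ν : Measure I) [SigmaFinite ν] (hν_int : Integrable (fun w : I => (w : ℝ)) ν)
    (w : ℕ → Ω → I) (hw : IsPoissonPointProcess P w ν)
    (n : ℕ) (M : Sym2 ℕ → Ω → ℕ) (hM : IsEdgeMultiplicity P w n M) :
    (∀ w : I, Integrable (fun v : I => 1 - (1 - (w : ℝ) * v) ^ n) ν) ∧
    Integrable (fun w : I => 1 - Real.exp (-∫ v : I, (1 - (1 - (w : ℝ) * v) ^ n) ∂ν)) ν ∧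
    Integrable (fun p : I × I => (p.1 : ℝ) * p.2) (ν.prod ν) ∧
    Integrable (fun p : I × I => 1 - (1 - (p.1 : ℝ) * p.2) ^ n) (ν.prod ν) ∧
    HasExpectation P (fun ω => vertexCount (binaryGraph fun e => M e ω))
      (∫ w : I, (1 - Real.exp (-∫ v : I, (1 - (1 - (w : ℝ) * v) ^ n) ∂ν)) ∂ν) ∧
    HasExpectation P (fun ω => vertexCount fun e => M e ω)
      (∫ w : I, (1 - Real.exp (-∫ v : I, (1 - (1 - (w : ℝ) * v) ^ n) ∂ν)) ∂ν) ∧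
    HasExpectation P (fun ω => edgeCount fun e => M e ω)
      ((n : ℝ) / 2 * ∫ v : I, ∫ w : I, (w : ℝ) * v ∂ν ∂ν) ∧
    HasExpectation P (fun ω => edgeCount (binaryGraph fun e => M e ω))
      ((1 : ℝ) / 2 * ∫ v : I, ∫ w : I, (1 - (1 - (w : ℝ) * v) ^ n) ∂ν ∂ν) := by
  have hrate : Integrable (fun p : I × I => (p.1 : ℝ) * p.2) (ν.prod ν) := hν_int.mul_prod hν_int
  have hedge : Integrable (fun p : I × I => 1 - (1 - (p.1 : ℝ) * p.2) ^ n) (ν.prod ν) :=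
    integrable_one_sub_one_sub_pow n hrate fun p => (p.1 * p.2).2
  have hdegree (x : I) : Integrable (fun y : I => 1 - (1 - (x : ℝ) * y) ^ n) ν :=
    integrable_one_sub_one_sub_pow n (hν_int.const_mul (x : ℝ)) fun y => (x * y).2
  have hactive := integrable_one_sub_exp_neg hedge.integral_prod_left fun x =>
    integral_nonneg fun y => one_sub_one_sub_pow_nonneg n (x * y)
  have hvertex := hw.hasExpectation_vertexCount hM hdegree hactive
  refine ⟨hdegree, hactive, hrate, hedge, ?_, hvertex, hw.hasExpectation_edgeCount hM hrate,
    hw.hasExpectation_edgeCount_binaryGraph hM hedge⟩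
  simpa only [vertexCount, activeVertices_binaryGraph] using hvertex

theorem lemma2 {Ω : Type*} [MeasurableSpace Ω] (P : Measure Ω) [IsProbabilityMeasure P]
    (ν : Measure I) [SigmaFinite ν] [NullSingletonClass ν]
    (hν_inf : ν Set.univ = ∞) (hν_int : Integrable (fun w : I => (w : ℝ)) ν)
    (w : ℕ → Ω → I) (hw : IsPoissonPointProcess P w ν)
    (n : ℕ) (M : Sym2 ℕ → Ω → ℕ) (hM : IsEdgeMultiplicity P w n M) :
    -- the integrals in the formulas converge
    (∀ w : I, Integrable (fun v : I => 1 - (1 - (w : ℝ) * v) ^ n) ν) ∧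
    Integrable (fun w : I => 1 - Real.exp (-∫ v : I, (1 - (1 - (w : ℝ) * v) ^ n) ∂ν)) ν ∧
    Integrable (fun p : I × I => (p.1 : ℝ) * p.2) (ν.prod ν) ∧
    Integrable (fun p : I × I => 1 - (1 - (p.1 : ℝ) * p.2) ^ n) (ν.prod ν) ∧
    -- vertices of the binary graph and of the multigraph
    HasExpectation P (fun ω => vertexCount (binaryGraph fun e => M e ω))
      (∫ w : I, (1 - Real.exp (-∫ v : I, (1 - (1 - (w : ℝ) * v) ^ n) ∂ν)) ∂ν) ∧
    HasExpectation P (fun ω => vertexCount fun e => M e ω)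
      (∫ w : I, (1 - Real.exp (-∫ v : I, (1 - (1 - (w : ℝ) * v) ^ n) ∂ν)) ∂ν) ∧
    -- edges of the multigraph
    HasExpectation P (fun ω => edgeCount fun e => M e ω)
      ((n : ℝ) / 2 * ∫ v : I, ∫ w : I, (w : ℝ) * v ∂ν ∂ν) ∧
    -- edges of the binary graph
    HasExpectation P (fun ω => edgeCount (binaryGraph fun e => M e ω))
      ((1 : ℝ) / 2 * ∫ v : I, ∫ w : I, (1 - (1 - (w : ℝ) * v) ^ n) ∂ν ∂ν) :=
  lemma2_general P ν hν_int w hw n M hM
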